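/- Alice and Bob play War with a deck of $n$ cards labeled $1,\dots,n$. In each round both players reveal the top card of their hand, and the player with the higher card puts both cards at the bottom of their own hand: with \emph{WL-putback} the winning card is put back first and the losing card second; with \emph{random putback} the order of the two cards is decided in each round by an independent fair coin. The game ends when one player, the loser, has no cards left. A \emph{passthrough} of a player who holds $j$ cards consists of the next $j$ rounds; the first passthrough starts at the beginning of the game and each further one starts when the previous one is completed. A game is \emph{single-use} if Bob wins during his first passthrough, and it is a \emph{$k$-passthrough game} if it ends within the first $k$ passthroughs of Alice. An \emph{$m$-card state} is an ordering of the deck together with the deal that gives Alice its first $m$ cards and Bob the remaining $n-m$ cards, each hand listed from top to bottom. Define $P_1=\tfrac12$ and $P_{k+1}=\tfrac12+\tfrac12P_k^2$ for $k\ge 1$. Theorem. Let $k\ge 1$, $m\ge 0$ and $n\ge 2^k m$ be integers, and let the initial state be chosen uniformly among the $n!$ $m$-card states (for random putback, independently of the coins). Then the probability that the game is both single-use and $k$-passthrough equals $P_k^m$, (a) when the game is played with random putback, and (b) when the game is played with WL-putback. (If $m=0$, Alice is regarded as having lost after $0$ rounds.) -/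

import Mathlib

open MeasureTheory

namespace War

/-- A state of the game: the hands of Alice and Bob, each listed from top to bottom. -/
structure State (α : Type*) where
  alice : List α
  bob : List α

/-- One round. The arguments of `order` are the winning and the losing card; its value lists the
two cards in the order in which the winner puts them to the bottom of the hand.
Nothing happens when one of the hands is empty, since the game is then over. -/
def playRound {α : Type*} [LinearOrder α] (order : α → α → List α) : State α → State α
  | ⟨a :: as, b :: bs⟩ =>
      if b < a then ⟨as ++ order a b, bs⟩ else ⟨as, bs ++ order b a⟩
  | s => s

/-- The course of the game from the state `s`: `play order s t` is the state after `t` rounds,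
where `order t` is the putback order used in the round that follows `t` completed rounds. -/
def play {α : Type*} [LinearOrder α] (order : ℕ → α → α → List α) (s : State α) : ℕ → State α
  | 0 => s
  | t + 1 => playRound (order t) (play order s t)

/-- WL-putback: the winning card is put back first, the losing card second. -/
def wlOrder {α : Type*} (_ : ℕ) (w l : α) : List α := [w, l]

/-- Random putback: the coin `c t` decides the order in which the two cards are put back. -/
def coinOrder {α : Type*} (c : ℕ → Bool) (t : ℕ) (w l : α) : List α :=
  if c t then [w, l] else [l, w]

/-- The game with course `g` ends after exactly `R` rounds. -/
def EndsAt {α : Type*} (g : ℕ → State α) (R : ℕ) : Prop :=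
  ((g R).alice = [] ∨ (g R).bob = []) ∧ ∀ t < R, (g t).alice ≠ [] ∧ (g t).bob ≠ []

/-- Bob wins during the first passthrough of his initial hand. -/
def IsSingleUse {α : Type*} (g : ℕ → State α) : Prop :=
  ∃ R, EndsAt g R ∧ (g R).alice = [] ∧ R ≤ (g 0).bob.length

/-- The number of rounds after which Alice's first `i` passthroughs are completed: a passthrough
that starts when she holds `j` cards lasts `j` rounds. -/
def passthroughEnd {α : Type*} (g : ℕ → State α) : ℕ → ℕ
  | 0 => 0
  | i + 1 => passthroughEnd g i + (g (passthroughEnd g i)).alice.length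

/-- The game ends within `k` passthroughs for Alice. -/
def IsPassthrough {α : Type*} (k : ℕ) (g : ℕ → State α) : Prop :=
  ∃ R, EndsAt g R ∧ R ≤ passthroughEnd g k

/-- The `m`-card state in which Alice holds the first `m` of the cards `σ 0, σ 1, …`
and Bob holds the others. The deck is `Fin n`; only the order of the cards matters. -/
def deal {n : ℕ} (m : ℕ) (σ : Equiv.Perm (Fin n)) : State (Fin n) :=
  ⟨(List.ofFn σ).take m, (List.ofFn σ).drop m⟩

instance permMeasurableSpace (n : ℕ) : MeasurableSpace (Equiv.Perm (Fin n)) := ⊤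

/-- The uniform distribution on the arrangements of the deck. -/
noncomputable def uniformPerm (n : ℕ) : Measure (Equiv.Perm (Fin n)) :=
  (PMF.uniformOfFintype (Equiv.Perm (Fin n))).toMeasure

/-- The law of a sequence of independent fair coins. -/
noncomputable def fairCoins : Measure (ℕ → Bool) :=
  Measure.infinitePi fun _ => (PMF.uniformOfFintype Bool).toMeasure

/-- The sequence with `P 1 = 1 / 2` and `P (k + 1) = 1 / 2 + P k ^ 2 / 2` for `k ≥ 1`
(the value at `0` is not used). -/
noncomputable def P : ℕ → ℝ
  | 0 => 0
  | 1 => 1 / 2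
  | k + 2 => 1 / 2 + 1 / 2 * P (k + 1) ^ 2

end War

namespace War

/-! Fix the coins; WL-putback is the case of constant coins. A passthrough at most doubles Alice's
hand, so `k` of them take at most `(2 ^ k - 1) * m ≤ n - m` rounds: Bob plays only cards of his
initial hand, and the event says that Alice's hand is then empty
(`singleUse_and_passthrough_deal_iff`).

If the cards were drawn independently from an `N`-element order, Alice's cards would found
independent branching families: a card `a` meets a fresh `b` and leaves nothing or the pair `a`,
`b`. The order within the pair is irrelevant. The event then has probability equal to the `m`-th
power of an average (`listAverage_extinct`) which, by the symmetry of `a` and `b`, obeys the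
recursion of `P` up to `1 / N` (`abs_average_extinction_succ_sub_le`).

Draws without repetition are in uniformly random relative order, and repetitions become negligible
as `N → ∞` (`abs_listAverage_sub_permAverage_le`). As the uniform permutation does not involve `N`,
its probability is exactly `P k ^ m`, for every coin sequence; Fubini handles random coins. -/

theorem length_coinOrder {α : Type*} (c : ℕ → Bool) (t : ℕ) (w l : α) :
    (coinOrder c t w l).length = 2 := by
  unfold coinOrder; split <;> rfl

theorem map_coinOrder {α β : Type*} (y : α → β) (c : ℕ → Bool) (t : ℕ) (w l : α) :
    (coinOrder c t w l).map y = coinOrder c t (y w) (y l) := by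
  unfold coinOrder; split <;> rfl

theorem passthroughEnd_succ_eq_add {α : Type*} (g : ℕ → State α) (k : ℕ) :
    passthroughEnd g (k + 1) =
      (g 0).alice.length + passthroughEnd (fun t => g ((g 0).alice.length + t)) k := by
  induction k with
  | zero => simp [passthroughEnd]
  | succ k ih => rw [passthroughEnd, ih, passthroughEnd]; omega

theorem two_pow_succ_sub_one_mul (k m : ℕ) :
    (2 ^ (k + 1) - 1) * m = m + (2 ^ k - 1) * (2 * m) := by
  obtain ⟨p, hp⟩ : ∃ p, 2 ^ k = p + 1 := ⟨2 ^ k - 1, by have := Nat.two_pow_pos k; omega⟩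
  have : 2 ^ (k + 1) - 1 = 2 * p + 1 := by rw [pow_succ, hp]; omega
  rw [this, hp, Nat.add_sub_cancel]; ring

/-! ### Course of the game for fixed coins -/

section Course

variable {α : Type*} [LinearOrder α]

/-- The cards, in the order of putback, that Alice holds after a passthrough in which she plays
the cards of the first list against those of the second one. -/
def won (c : ℕ → Bool) : List α → List α → List α
  | a :: as, b :: bs =>
      (if b < a then coinOrder c 0 a b else []) ++ won (fun i => c (1 + i)) as bs
  | _, _ => []

/-- Alice's hand after `k` passthroughs, if she starts with `hand` and Bob plays the cards
of `fresh`. -/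
def survivors : (ℕ → Bool) → ℕ → List α → List α → List α
  | _, 0, hand, _ => hand
  | c, k + 1, hand, fresh =>
      survivors (fun i => c (hand.length + i)) k (won c hand (fresh.take hand.length))
        (fresh.drop hand.length)

theorem length_won_le (c : ℕ → Bool) (as bs : List α) : (won c as bs).length ≤ 2 * as.length := by
  induction as generalizing c bs with
  | nil => simp [won]
  | cons a as ih =>
    cases bs with
    | nil => simp [won]
    | cons b bs =>
      have := ih (fun i => c (1 + i)) bs
      simp only [won, List.length_append, List.length_cons]
      split
      · rw [length_coinOrder]; omega
      · simp only [List.length_nil]; omega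

theorem play_add (order : ℕ → α → α → List α) (s : State α) (a b : ℕ) :
    play order s (a + b) = play (fun i => order (a + i)) (play order s a) b := by
  induction b with
  | zero => rfl
  | succ b ih => rw [← add_assoc]; simp only [play, ih]

/-- Bob's winnings `w` go below `v`, so their content does not matter while `v` lasts. -/
theorem play_length_eq_won (c : ℕ → Bool) (as bs u v : List α) (h : as.length = bs.length) :
    ∃ w, play (coinOrder c) ⟨as ++ u, bs ++ v⟩ as.length = ⟨u ++ won c as bs, v ++ w⟩ := by
  induction as generalizing c bs u v with
  | nil =>
    obtain rfl : bs = [] := by simpa using h.symm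
    exact ⟨[], by simp [play, won]⟩
  | cons a as ih =>
    cases bs with
    | nil => simp at h
    | cons b bs =>
      have h' : as.length = bs.length := by simpa using h
      rw [List.length_cons, add_comm, play_add]
      change ∃ w, play (coinOrder fun i => c (1 + i)) _ _ = _
      by_cases hab : b < a
      · obtain ⟨w, hw⟩ := ih (fun i => c (1 + i)) bs (u ++ coinOrder c 0 a b) v h'
        refine ⟨w, ?_⟩
        simpa [play, playRound, won, hab] using hw
      · obtain ⟨w, hw⟩ := ih (fun i => c (1 + i)) bs u (v ++ coinOrder c 0 b a) h'
        refine ⟨coinOrder c 0 b a ++ w, ?_⟩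
        simpa [play, playRound, won, hab] using hw

/-- Hand sizes at most double, whence the bound `1 + 2 + ⋯ + 2 ^ (k - 1)` per initial card. The
induction splits off the first passthrough; the tail `v` absorbs what Bob has won. -/
theorem play_passthroughEnd (c : ℕ → Bool) (k : ℕ) (hand fresh v : List α)
    (h : (2 ^ k - 1) * hand.length ≤ fresh.length) :
    passthroughEnd (play (coinOrder c) ⟨hand, fresh ++ v⟩) k ≤ (2 ^ k - 1) * hand.length ∧
    (play (coinOrder c) ⟨hand, fresh ++ v⟩
      (passthroughEnd (play (coinOrder c) ⟨hand, fresh ++ v⟩) k)).alice =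
        survivors c k hand fresh := by
  induction k generalizing c hand fresh v with
  | zero => simp [passthroughEnd, survivors, play]
  | succ k ih =>
    rw [two_pow_succ_sub_one_mul] at h ⊢
    have hle : hand.length ≤ fresh.length := by omega
    have hwon := Nat.mul_le_mul_left (2 ^ k - 1)
      (length_won_le c hand (fresh.take hand.length))
    obtain ⟨w, hw⟩ := play_length_eq_won c hand (fresh.take hand.length) []
      (fresh.drop hand.length ++ v) (by simp [hle])
    rw [List.append_nil, ← List.append_assoc, List.take_append_drop, List.nil_append,
      List.append_assoc] at hw
    obtain ⟨h1, h2⟩ := ih (fun i => c (hand.length + i)) (won c hand (fresh.take hand.length))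
      (fresh.drop hand.length) (v ++ w) (by rw [List.length_drop]; omega)
    have hplay : (fun t => play (coinOrder c) ⟨hand, fresh ++ v⟩ (hand.length + t)) =
        play (coinOrder fun i => c (hand.length + i))
          ⟨won c hand (fresh.take hand.length), fresh.drop hand.length ++ (v ++ w)⟩ := by
      funext t
      rw [play_add, hw]; rfl
    rw [passthroughEnd_succ_eq_add]
    change hand.length + passthroughEnd
      (fun t => play (coinOrder c) ⟨hand, fresh ++ v⟩ (hand.length + t)) k ≤ _ ∧
      ((fun t => play (coinOrder c) ⟨hand, fresh ++ v⟩ (hand.length + t)) (passthroughEnd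
      (fun t => play (coinOrder c) ⟨hand, fresh ++ v⟩ (hand.length + t)) k)).alice = _
    rw [hplay]
    exact ⟨by omega, h2⟩

theorem play_eq_of_ended (order : ℕ → α → α → List α) (s : State α) {R T : ℕ} (hRT : R ≤ T)
    (h : (play order s R).alice = [] ∨ (play order s R).bob = []) :
    play order s T = play order s R := by
  induction T, hRT using Nat.le_induction with
  | base => rfl
  | succ T _ ih =>
    rw [play, ih]
    rcases hs : play order s R with ⟨_ | ⟨a, as⟩, _ | ⟨b, bs⟩⟩ <;> simp_all [playRound]

/-- A finished game stays frozen, so its outcome can be read off at the end of passthrough `k`. -/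
theorem singleUse_and_passthrough_iff (order : ℕ → α → α → List α) (s : State α) (k : ℕ)
    (h : passthroughEnd (play order s) k ≤ s.bob.length) :
    IsSingleUse (play order s) ∧ IsPassthrough k (play order s) ↔
      (play order s (passthroughEnd (play order s) k)).alice = [] := by
  constructor
  · rintro ⟨⟨R, hR, hA, -⟩, R', hR', hle⟩
    have hRR' : R ≤ R' := by
      by_contra! hlt
      have := hR.2 _ hlt
      rcases hR'.1 with h | h <;> simp_all
    rw [play_eq_of_ended order s (hRR'.trans hle) hR.1, hA]
  · intro hA
    classical
    have hex : ∃ R, (play order s R).alice = [] ∨ (play order s R).bob = [] := ⟨_, Or.inl hA⟩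
    have hle := Nat.find_min' hex (Or.inl hA)
    have hend : EndsAt (play order s) (Nat.find hex) :=
      ⟨Nat.find_spec hex, fun t ht => by simpa using Nat.find_min hex ht⟩
    refine ⟨⟨_, hend, ?_, hle.trans h⟩, _, hend, hle⟩
    rw [← play_eq_of_ended order s hle hend.1, hA]

theorem won_map {β : Type*} [LinearOrder β] {y : α → β} (hy : StrictMono y) (c : ℕ → Bool)
    (as bs : List α) : won c (as.map y) (bs.map y) = (won c as bs).map y := by
  induction as generalizing c bs with
  | nil => simp [won]
  | cons a as ih =>
    cases bs with
    | nil => simp [won]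
    | cons b bs =>
      simp only [List.map_cons, won, hy.lt_iff_lt, ih, List.map_append]
      split <;> simp [map_coinOrder]

theorem survivors_map {β : Type*} [LinearOrder β] {y : α → β} (hy : StrictMono y)
    (c : ℕ → Bool) (k : ℕ) (hand fresh : List α) :
    survivors c k (hand.map y) (fresh.map y) = (survivors c k hand fresh).map y := by
  induction k generalizing c hand fresh with
  | zero => rfl
  | succ k ih =>
    simp only [survivors, List.length_map, ← List.map_take, ← List.map_drop, won_map hy, ih]

/-- The indicator of the event that Alice has lost her `m` cards after `k` passthroughs against
fresh cards of Bob, the cards being dealt in the order given by the list. -/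
noncomputable def extinct (c : ℕ → Bool) (k m : ℕ) (l : List α) : ℝ :=
  0 ^ (survivors c k (l.take m) (l.drop m)).length

theorem extinct_map {β : Type*} [LinearOrder β] {y : α → β} (hy : StrictMono y)
    (c : ℕ → Bool) (k m : ℕ) (l : List α) : extinct c k m (l.map y) = extinct c k m l := by
  simp only [extinct, ← List.map_take, ← List.map_drop, survivors_map hy, List.length_map]

theorem extinct_mem_Icc (c : ℕ → Bool) (k m : ℕ) (l : List α) :
    extinct c k m l ∈ Set.Icc (0 : ℝ) 1 :=
  ⟨by unfold extinct; positivity, pow_le_one₀ le_rfl zero_le_one⟩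

end Course

theorem play_deal_passthroughEnd (c : ℕ → Bool) {k m n : ℕ} (hn : 2 ^ k * m ≤ n)
    (σ : Equiv.Perm (Fin n)) :
    passthroughEnd (play (coinOrder c) (deal m σ)) k ≤ (deal m σ).bob.length ∧
    (play (coinOrder c) (deal m σ) (passthroughEnd (play (coinOrder c) (deal m σ)) k)).alice =
      survivors c k ((List.ofFn σ).take m) ((List.ofFn σ).drop m) := by
  have hm : m ≤ n := (Nat.le_mul_of_pos_left m (Nat.two_pow_pos k)).trans hn
  have hlen : (2 ^ k - 1) * ((List.ofFn σ).take m).length ≤ ((List.ofFn σ).drop m).length := by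
    simp only [List.length_take, List.length_drop, List.length_ofFn, min_eq_left hm,
      Nat.sub_mul, one_mul]
    omega
  obtain ⟨h1, h2⟩ := play_passthroughEnd c k _ _ [] hlen
  rw [List.append_nil] at h1 h2
  exact ⟨h1.trans hlen, h2⟩

theorem singleUse_and_passthrough_deal_iff (c : ℕ → Bool) {k m n : ℕ} (hn : 2 ^ k * m ≤ n)
    (σ : Equiv.Perm (Fin n)) :
    (IsSingleUse (play (coinOrder c) (deal m σ)) ∧
      IsPassthrough k (play (coinOrder c) (deal m σ))) ↔
    survivors c k ((List.ofFn σ).take m) ((List.ofFn σ).drop m) = [] := by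
  obtain ⟨h1, h2⟩ := play_deal_passthroughEnd c hn σ
  rw [singleUse_and_passthrough_iff _ _ _ h1, h2]


/-! ### Cards drawn with replacement: a branching process -/

section Average

variable {α : Type*} [Fintype α]

/-- The average of `f` over all lists of length `n`. -/
noncomputable def listAverage : ℕ → (List α → ℝ) → ℝ
  | 0, f => f []
  | n + 1, f => (∑ x, listAverage n fun l => f (x :: l)) / Fintype.card α

theorem listAverage_congr {n : ℕ} {f g : List α → ℝ} (h : ∀ l, l.length = n → f l = g l) :
    listAverage n f = listAverage n g := by
  induction n generalizing f g with
  | zero => exact h [] rfl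
  | succ n ih =>
    simp only [listAverage]
    congr 1
    exact Finset.sum_congr rfl fun x _ => ih fun l hl => h _ (by simp [hl])

theorem listAverage_const_mul (n : ℕ) (r : ℝ) (f : List α → ℝ) :
    listAverage n (fun l => r * f l) = r * listAverage n f := by
  induction n generalizing f with
  | zero => rfl
  | succ n ih => simp only [listAverage, ih, ← Finset.mul_sum, mul_div_assoc]

theorem listAverage_add (m n : ℕ) (f : List α → ℝ) :
    listAverage (m + n) f = listAverage m fun u => listAverage n fun v => f (u ++ v) := by
  induction m generalizing f with
  | zero => simp [listAverage]
  | succ m ih => rw [Nat.succ_add]; simp only [listAverage, ih, List.cons_append]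

theorem listAverage_eq_sum (n : ℕ) (f : List α → ℝ) :
    listAverage n f = (∑ x : Fin n → α, f (List.ofFn x)) / (Fintype.card α : ℝ) ^ n := by
  induction n generalizing f with
  | zero => simp [listAverage]
  | succ n ih =>
    simp only [listAverage, ih]
    rw [← Finset.sum_div, div_div, ← pow_succ, ← Fintype.sum_prod_type',
      Fintype.sum_equiv (Fin.consEquiv fun _ => α) _ fun x => f (List.ofFn x)]
    simp [Fin.consEquiv, List.ofFn_succ]

variable [LinearOrder α]

/-- If Bob plays fresh cards drawn from `α` with replacement, then `extinction k a` is the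
probability that a card `a` of Alice, together with all the cards won by means of it, is lost
within `k` passthroughs. -/
noncomputable def extinction : ℕ → α → ℝ
  | 0, _ => 0
  | k + 1, a => (∑ b, if b < a then extinction k a * extinction k b else 1) / Fintype.card α

/-- Each card of the hand meets its own independent opponent, so the average factorizes; the putback
order disappears by commutativity. -/
theorem listAverage_won [Nonempty α] (c : ℕ → Bool) (k : ℕ) (hand : List α) :
    listAverage hand.length (fun u => ((won c hand u).map (extinction k)).prod) =
      (hand.map (extinction (k + 1))).prod := by
  induction hand generalizing c with
  | nil => simp [listAverage, won]
  | cons a as ih =>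
    simp only [List.length_cons, listAverage, won, List.map_append, List.prod_append,
      listAverage_const_mul, ih, List.map_cons, List.prod_cons, extinction]
    rw [← Finset.sum_mul, div_mul_eq_mul_div]
    congr 2
    refine Finset.sum_congr rfl fun b _ => ?_
    split
    · unfold coinOrder; split <;> simp [mul_comm]
    · simp

theorem listAverage_survivors [Nonempty α] (c : ℕ → Bool) (k n : ℕ) (hand : List α)
    (h : (2 ^ k - 1) * hand.length ≤ n) :
    listAverage n (fun u => (0 : ℝ) ^ (survivors c k hand u).length) =
      (hand.map (extinction k)).prod := by
  induction k generalizing c n hand with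
  | zero =>
    have key (r : ℝ) : listAverage n (fun _ : List α => r) = r := by
      rw [listAverage_eq_sum]; simp
    simp only [survivors, key]
    -- Since `extinction 0` vanishes, the product over the hand is `0 ^ hand.length`.
    induction hand <;> simp_all [extinction]
  | succ k ih =>
    rw [two_pow_succ_sub_one_mul] at h
    obtain ⟨n, rfl⟩ := Nat.exists_eq_add_of_le (Nat.le_of_add_right_le h)
    rw [listAverage_add, ← listAverage_won c]
    refine listAverage_congr fun u hu => ?_
    simp only [survivors, ← hu, List.take_left', List.drop_left']
    refine ih _ _ _ ?_
    have hwon := Nat.mul_le_mul_left (2 ^ k - 1) (length_won_le c hand u)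
    omega

theorem listAverage_extinct [Nonempty α] (c : ℕ → Bool) {k m n : ℕ} (hn : 2 ^ k * m ≤ n) :
    listAverage n (extinct (α := α) c k m) =
      ((∑ a : α, extinction k a) / Fintype.card α) ^ m := by
  have hm : m ≤ n := (Nat.le_mul_of_pos_left m (Nat.two_pow_pos k)).trans hn
  obtain ⟨n, rfl⟩ := Nat.exists_eq_add_of_le hm
  have key (g : α → ℝ) (m : ℕ) :
      listAverage m (fun l => (l.map g).prod) = ((∑ a, g a) / Fintype.card α) ^ m := by
    induction m with
    | zero => simp [listAverage]
    | succ m ih =>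
      simp only [listAverage, List.map_cons, List.prod_cons, listAverage_const_mul, ih]
      rw [← Finset.sum_mul, pow_succ, mul_div_right_comm, mul_comm]
  rw [listAverage_add, ← key]
  refine listAverage_congr fun u hu => ?_
  simp only [extinct, List.take_left' hu, List.drop_left' hu]
  refine listAverage_survivors c k n u ?_
  rw [hu, Nat.sub_mul]
  omega

theorem extinction_mem_Icc [Nonempty α] (k : ℕ) (a : α) :
    extinction k a ∈ Set.Icc (0 : ℝ) 1 := by
  induction k generalizing a with
  | zero => simp [extinction]
  | succ k ih =>
    have hb (b : α) : (if b < a then extinction k a * extinction k b else 1) ∈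
        Set.Icc (0 : ℝ) 1 := by
      split
      · exact ⟨mul_nonneg (ih a).1 (ih b).1, mul_le_one₀ (ih a).2 (ih b).1 (ih b).2⟩
      · simp
    refine ⟨div_nonneg (Finset.sum_nonneg fun b _ => (hb b).1) (Nat.cast_nonneg _),
      div_le_one_of_le₀ ?_ (Nat.cast_nonneg _)⟩
    exact (Finset.sum_le_card_nsmul _ _ 1 fun b _ => (hb b).2).trans (by simp)

theorem two_mul_sum_sum_lt (f : α → ℝ) :
    2 * ∑ a, ∑ b, (if b < a then f a * f b else 0) = (∑ a, f a) ^ 2 - ∑ a, f a ^ 2 := by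
  have hswap : ∑ a, ∑ b, (if b < a then f a * f b else 0) =
      ∑ a, ∑ b, (if a < b then f a * f b else 0) := by
    rw [Finset.sum_comm]
    simp only [mul_comm]
  have hdiag : ∑ a, f a ^ 2 = ∑ a, ∑ b, (if a = b then f a * f b else 0) := by
    simp [sq]
  rw [eq_sub_iff_add_eq, two_mul, hdiag]
  nth_rewrite 2 [hswap]
  rw [sq, Finset.sum_mul_sum, ← Finset.sum_add_distrib, ← Finset.sum_add_distrib]
  refine Finset.sum_congr rfl fun a _ => ?_
  rw [← Finset.sum_add_distrib, ← Finset.sum_add_distrib]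
  refine Finset.sum_congr rfl fun b _ => ?_
  rcases lt_trichotomy a b with h | h | h
  · simp [h, h.ne, h.not_gt]
  · simp [h]
  · simp [h, h.ne', h.not_gt]

/-- Pairs `b < a` carry half of the square of the sum, up to the diagonal. Only the diagonal, which
is the ties, contributes an error. -/
theorem abs_average_extinction_succ_sub_le [Nonempty α] (k : ℕ) :
    |(∑ a : α, extinction (k + 1) a) / (Fintype.card α : ℝ) -
      (1 / 2 + 1 / 2 * ((∑ a : α, extinction k a) / (Fintype.card α : ℝ)) ^ 2)| ≤
        1 / (Fintype.card α : ℝ) := by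
  have hN : (0 : ℝ) < Fintype.card α := by exact_mod_cast Fintype.card_pos
  have h1 := two_mul_sum_sum_lt fun a : α => extinction k a
  have h2 := two_mul_sum_sum_lt fun _ : α => (1 : ℝ)
  have hsplit : ∑ a : α, ∑ b : α, (if b < a then extinction k a * extinction k b else 1) =
      ∑ a : α, ∑ b : α, (if b < a then extinction k a * extinction k b else 0) +
        ((Fintype.card α : ℝ) ^ 2 - ∑ a : α, ∑ b : α, (if b < a then (1 : ℝ) * 1 else 0)) := by
    have hcard : (Fintype.card α : ℝ) ^ 2 = ∑ a : α, ∑ b : α, (1 : ℝ) := by simp [sq]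
    rw [hcard, ← Finset.sum_sub_distrib, ← Finset.sum_add_distrib]
    refine Finset.sum_congr rfl fun a _ => ?_
    rw [← Finset.sum_sub_distrib, ← Finset.sum_add_distrib]
    refine Finset.sum_congr rfl fun b _ => ?_
    split <;> simp
  have hsq0 : 0 ≤ ∑ a : α, extinction k a ^ 2 := Finset.sum_nonneg fun _ _ => sq_nonneg _
  have hsq1 : ∑ a : α, extinction k a ^ 2 ≤ Fintype.card α :=
    (Finset.sum_le_card_nsmul _ _ 1 fun a _ =>
      pow_le_one₀ (extinction_mem_Icc k a).1 (extinction_mem_Icc k a).2).trans (by simp)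
  simp only [Finset.sum_const, Finset.card_univ, nsmul_eq_mul, mul_one, one_pow] at h2
  simp only [mul_one] at hsplit
  simp only [extinction]
  rw [← Finset.sum_div, hsplit, div_div]
  set N : ℝ := (Fintype.card α : ℝ)
  have : (∑ a : α, ∑ b : α, (if b < a then extinction k a * extinction k b else 0) +
      (N ^ 2 - ∑ a : α, ∑ b : α, (if b < a then (1 : ℝ) else 0))) / (N * N) -
      (1 / 2 + 1 / 2 * ((∑ a : α, extinction k a) / N) ^ 2) =
      (N - ∑ a : α, extinction k a ^ 2) / 2 / (N * N) := by
    field_simp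
    linear_combination h1 - h2
  rw [this, abs_le]
  constructor
  · have : 0 ≤ (N - ∑ a : α, extinction k a ^ 2) / 2 / (N * N) :=
      div_nonneg (by linarith) (by positivity)
    have : 0 ≤ 1 / N := by positivity
    linarith
  · rw [div_le_div_iff₀ (by positivity) hN]
    nlinarith

end Average


/-! ### Limit of many card values -/

open Filter Topology in
theorem tendsto_average_extinction (k : ℕ) :
    Tendsto (fun N : ℕ => (∑ a : Fin (N + 1), extinction k a) / ((N : ℝ) + 1)) atTop
      (𝓝 (P k)) := by
  -- The value `P 0 = 0` extends the recursion to `k = 0`.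
  have hP : ∀ k, P (k + 1) = 1 / 2 + 1 / 2 * P k ^ 2
    | 0 => by simp [P]
    | k + 1 => rfl
  induction k with
  | zero => simp [extinction, P]
  | succ k ih =>
    have hlim : Tendsto (fun N : ℕ => 1 / 2 +
        1 / 2 * ((∑ a : Fin (N + 1), extinction k a) / ((N : ℝ) + 1)) ^ 2) atTop
        (𝓝 (P (k + 1))) := by
      rw [hP]
      exact ((ih.pow 2).const_mul _).const_add _
    have hdiff := squeeze_zero_norm
      (f := fun N : ℕ => (∑ a : Fin (N + 1), extinction (k + 1) a) / ((N : ℝ) + 1) -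
        (1 / 2 + 1 / 2 * ((∑ a : Fin (N + 1), extinction k a) / ((N : ℝ) + 1)) ^ 2))
      (fun N : ℕ => by simpa using abs_average_extinction_succ_sub_le (α := Fin (N + 1)) k)
      (by simpa using tendsto_one_div_add_atTop_nhds_zero_nat (𝕜 := ℝ))
    simpa using hdiff.add hlim

/-! ### Comparison with uniform permutations -/

/-- The proportion of the arrangements of the deck for which Alice has lost her `m` cards after
`k` passthroughs. -/
noncomputable def permAverage (c : ℕ → Bool) (k m n : ℕ) : ℝ :=
  (∑ σ : Equiv.Perm (Fin n), extinct c k m (List.ofFn σ)) / n.factorial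

/-- Only comparisons matter: sorting `x` turns it into a strictly increasing relabelling, and the
sorting permutation is absorbed by the sum. -/
theorem sum_perm_extinct_comp (c : ℕ → Bool) (k m n : ℕ) {α : Type*} [LinearOrder α]
    {x : Fin n → α} (hx : Function.Injective x) :
    (∑ σ : Equiv.Perm (Fin n), extinct c k m (List.ofFn (x ∘ σ))) / n.factorial =
      permAverage c k m n := by
  have hy : StrictMono (x ∘ Tuple.sort x) :=
    (Tuple.monotone_sort x).strictMono_of_injective (hx.comp (Tuple.sort x).injective)
  unfold permAverage
  congr 1
  refine Fintype.sum_equiv (Equiv.mulLeft (Tuple.sort x)⁻¹) _ _ fun σ => ?_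
  rw [← extinct_map hy, List.map_ofFn]
  congr 2
  funext i
  simp

theorem sum_extinct_eq (c : ℕ → Bool) (k m n : ℕ) {α : Type*} [LinearOrder α] [Fintype α] :
    ∑ x : Fin n → α, extinct c k m (List.ofFn x) =
      ∑ x : Fin n → α,
        (∑ σ : Equiv.Perm (Fin n), extinct c k m (List.ofFn (x ∘ σ))) / n.factorial := by
  rw [← Finset.sum_div, Finset.sum_comm]
  have h (σ : Equiv.Perm (Fin n)) : ∑ x : Fin n → α, extinct c k m (List.ofFn (x ∘ σ)) =
      ∑ x : Fin n → α, extinct c k m (List.ofFn x) :=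
    Fintype.sum_equiv (σ.symm.arrowCongr (Equiv.refl α)) _ _ fun _ => rfl
  simp only [h, Finset.sum_const, Finset.card_univ, Fintype.card_perm, Fintype.card_fin,
    nsmul_eq_mul]
  rw [mul_div_cancel_left₀ _ (by positivity)]

theorem permAverage_extinct_comp_mem_Icc (c : ℕ → Bool) (k m n : ℕ) {α : Type*} [LinearOrder α]
    (x : Fin n → α) :
    (∑ σ : Equiv.Perm (Fin n), extinct c k m (List.ofFn (x ∘ σ))) / n.factorial ∈
      Set.Icc (0 : ℝ) 1 := by
  refine ⟨div_nonneg (Finset.sum_nonneg fun σ _ => (extinct_mem_Icc ..).1) (Nat.cast_nonneg _),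
    div_le_one_of_le₀ ?_ (Nat.cast_nonneg _)⟩
  refine (Finset.sum_le_card_nsmul _ _ 1 fun σ _ => (extinct_mem_Icc ..).2).trans ?_
  simp [Fintype.card_perm]

/-- Averaging over rearrangements of each sample, injective samples contribute no error and the
others at most 1; the bound is the probability of a repetition. -/
theorem abs_listAverage_sub_permAverage_le (c : ℕ → Bool) (k m n : ℕ) {α : Type*}
    [LinearOrder α] [Fintype α] [Nonempty α] :
    |listAverage n (extinct (α := α) c k m) - permAverage c k m n| ≤
      1 - ((Fintype.card α).descFactorial n : ℝ) / (Fintype.card α : ℝ) ^ n := by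
  classical
  have hN : (0 : ℝ) < (Fintype.card α : ℝ) ^ n := by
    have : (0 : ℝ) < Fintype.card α := by exact_mod_cast Fintype.card_pos
    positivity
  have hq : permAverage c k m n ∈ Set.Icc (0 : ℝ) 1 :=
    permAverage_extinct_comp_mem_Icc c k m n (id : Fin n → Fin n)
  have hterm (x : Fin n → α) :
      |(∑ σ : Equiv.Perm (Fin n), extinct c k m (List.ofFn (x ∘ σ))) / n.factorial -
        permAverage c k m n| ≤ 1 - if Function.Injective x then (1 : ℝ) else 0 := by
    split
    · rename_i hx
      simp [sum_perm_extinct_comp c k m n hx]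
    · have := permAverage_extinct_comp_mem_Icc c k m n x
      rw [abs_le]
      constructor <;> linarith [this.1, this.2, hq.1, hq.2]
  have hcard : ∑ x : Fin n → α, (if Function.Injective x then (1 : ℝ) else 0) =
      (Fintype.card α).descFactorial n := by
    rw [Finset.sum_boole, ← Fintype.card_subtype,
      Fintype.card_congr (Equiv.subtypeInjectiveEquivEmbedding (Fin n) α),
      Fintype.card_embedding_eq, Fintype.card_fin]
  have hone : ∑ x : Fin n → α, (1 : ℝ) = (Fintype.card α : ℝ) ^ n := by simp
  have hsum : listAverage n (extinct (α := α) c k m) - permAverage c k m n =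
      (∑ x : Fin n → α,
        ((∑ σ : Equiv.Perm (Fin n), extinct c k m (List.ofFn (x ∘ σ))) / n.factorial -
          permAverage c k m n)) / (Fintype.card α : ℝ) ^ n := by
    rw [listAverage_eq_sum, sum_extinct_eq, Finset.sum_sub_distrib, sub_div]
    congr 1
    simp [mul_div_cancel_left₀ _ hN.ne']
  rw [hsum, abs_div, abs_of_pos hN, one_sub_div hN.ne', ← hcard, ← hone,
    ← Finset.sum_sub_distrib, hone]
  exact div_le_div_of_nonneg_right
    ((Finset.abs_sum_le_sum_abs _ _).trans (Finset.sum_le_sum fun x _ => hterm x)) hN.le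

open Filter Topology in
theorem permAverage_eq (c : ℕ → Bool) {k m n : ℕ} (hn : 2 ^ k * m ≤ n) :
    permAverage c k m n = P k ^ m := by
  have hlim : Tendsto (fun N : ℕ => listAverage n (extinct (α := Fin (N + 1)) c k m)) atTop
      (𝓝 (P k ^ m)) := by
    simp only [listAverage_extinct c hn, Fintype.card_fin, Nat.cast_add, Nat.cast_one]
    exact (tendsto_average_extinction k).pow m
  have hdesc : Tendsto (fun N : ℕ => 1 - ((N + 1).descFactorial n : ℝ) / ((N + 1 : ℕ) : ℝ) ^ n)
      atTop (𝓝 0) := by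
    have hz : ∀ᶠ N : ℕ in atTop, (N : ℝ) ^ n ≠ 0 :=
      eventually_atTop.mpr ⟨1, fun N hN => pow_ne_zero _ (Nat.cast_ne_zero.mpr (by omega))⟩
    have h := (Asymptotics.isEquivalent_iff_tendsto_one hz).mp (isEquivalent_descFactorial n)
    simpa using ((tendsto_add_atTop_iff_nat 1).mpr h).const_sub 1
  have hdiff : Tendsto (fun N : ℕ => listAverage n (extinct (α := Fin (N + 1)) c k m) -
      permAverage c k m n) atTop (𝓝 0) :=
    squeeze_zero_norm (fun N => by
      simpa using abs_listAverage_sub_permAverage_le c k m n (α := Fin (N + 1))) hdesc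
  have := hdiff.add_const (permAverage c k m n)
  simp only [sub_add_cancel, zero_add] at this
  exact tendsto_nhds_unique this hlim

/-! ### Probabilities and measurability in the coins -/

theorem uniformPerm_real_deal (c : ℕ → Bool) {k m n : ℕ} (hn : 2 ^ k * m ≤ n) :
    (uniformPerm n).real {σ : Equiv.Perm (Fin n) |
      IsSingleUse (play (coinOrder c) (deal m σ)) ∧
      IsPassthrough k (play (coinOrder c) (deal m σ))} = P k ^ m := by
  classical
  rw [← permAverage_eq c hn, Measure.real, uniformPerm,
    PMF.toMeasure_uniformOfFintype_apply _ MeasurableSpace.measurableSet_top, permAverage]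
  simp only [singleUse_and_passthrough_deal_iff c hn, extinct, zero_pow_eq, List.length_eq_zero_iff,
    Finset.sum_boole, ENNReal.toReal_div, ENNReal.toReal_natCast, Fintype.card_perm,
    Fintype.card_fin]
  rw [← Fintype.card_subtype]
  rfl

theorem isLocallyConstant_comp_nat {X Y : Type*} [TopologicalSpace X] {f : X → ℕ}
    {g : X → ℕ → Y} (hf : IsLocallyConstant f) (hg : ∀ t, IsLocallyConstant fun x => g x t) :
    IsLocallyConstant fun x => g x (f x) := by
  rw [IsLocallyConstant.iff_eventually_eq]
  intro x
  filter_upwards [hf.eventually_eq x, (hg (f x)).eventually_eq x] with y h1 h2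
  rw [h1, h2]

/-- Finitely many rounds read finitely many coins; hence the event is open, so measurable. -/
theorem isLocallyConstant_play {α : Type*} [LinearOrder α] (s : State α) (t : ℕ) :
    IsLocallyConstant fun c : ℕ → Bool => play (coinOrder c) s t := by
  induction t with
  | zero => exact IsLocallyConstant.const s
  | succ t ih =>
    exact ((IsLocallyConstant.iff_continuous _).mpr (continuous_apply t)).comp₂ ih
      fun b s => playRound (fun w l => if b then [w, l] else [l, w]) s

theorem isLocallyConstant_passthroughEnd {α : Type*} [LinearOrder α] (s : State α) (k : ℕ) :
    IsLocallyConstant fun c : ℕ → Bool => passthroughEnd (play (coinOrder c) s) k := by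
  induction k with
  | zero => exact IsLocallyConstant.const 0
  | succ k ih =>
    exact ih.comp₂ (isLocallyConstant_comp_nat ih (isLocallyConstant_play s))
      fun t s => t + s.alice.length

theorem measurableSet_singleUse_and_passthrough {k m n : ℕ} (hn : 2 ^ k * m ≤ n)
    (σ : Equiv.Perm (Fin n)) :
    MeasurableSet {c : ℕ → Bool | IsSingleUse (play (coinOrder c) (deal m σ)) ∧
      IsPassthrough k (play (coinOrder c) (deal m σ))} := by
  have h (c : ℕ → Bool) := singleUse_and_passthrough_iff (coinOrder c) (deal m σ) k
    (play_deal_passthroughEnd c hn σ).1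
  simp only [h]
  exact ((isLocallyConstant_comp_nat (isLocallyConstant_passthroughEnd (deal m σ) k)
    (isLocallyConstant_play (deal m σ))).comp State.alice).isOpen_fiber [] |>.measurableSet

instance (n : ℕ) : IsProbabilityMeasure (uniformPerm n) := by
  unfold uniformPerm; infer_instance

instance : IsProbabilityMeasure fairCoins := by
  unfold fairCoins; infer_instance

end War

theorem mainTheorem2 (k m n : ℕ) (hk : 1 ≤ k) (hn : 2 ^ k * m ≤ n) :
    ((War.uniformPerm n).prod War.fairCoins).real
        {p : Equiv.Perm (Fin n) × (ℕ → Bool) |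
          War.IsSingleUse (War.play (War.coinOrder p.2) (War.deal m p.1)) ∧
          War.IsPassthrough k (War.play (War.coinOrder p.2) (War.deal m p.1))} =
      War.P k ^ m ∧
    (War.uniformPerm n).real
        {σ : Equiv.Perm (Fin n) |
          War.IsSingleUse (War.play War.wlOrder (War.deal m σ)) ∧
          War.IsPassthrough k (War.play War.wlOrder (War.deal m σ))} =
      War.P k ^ m := by
  -- WL-putback is `coinOrder` with all coins `true`, by definition.
  refine ⟨?_, War.uniformPerm_real_deal (fun _ => true) hn⟩
  have hmeas : MeasurableSet {p : Equiv.Perm (Fin n) × (ℕ → Bool) |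
      War.IsSingleUse (War.play (War.coinOrder p.2) (War.deal m p.1)) ∧
      War.IsPassthrough k (War.play (War.coinOrder p.2) (War.deal m p.1))} := by
    have : DiscreteMeasurableSpace (Equiv.Perm (Fin n)) :=
      ⟨fun _ => MeasurableSpace.measurableSet_top⟩
    have hunion := MeasurableSet.iUnion fun σ : Equiv.Perm (Fin n) =>
      (measurableSet_singleton σ).prod (War.measurableSet_singleUse_and_passthrough hn σ)
    convert hunion using 1
    ext ⟨σ, c⟩
    simp
  have hsection (c : ℕ → Bool) := War.uniformPerm_real_deal c hn
  have hconst (c : ℕ → Bool) : War.uniformPerm n ((fun σ => (σ, c)) ⁻¹'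
      {p : Equiv.Perm (Fin n) × (ℕ → Bool) |
        War.IsSingleUse (War.play (War.coinOrder p.2) (War.deal m p.1)) ∧
        War.IsPassthrough k (War.play (War.coinOrder p.2) (War.deal m p.1))}) =
      ENNReal.ofReal (War.P k ^ m) := by
    rw [← hsection c, ofReal_measureReal]
    rfl
  -- The permutation is integrated first: each section at fixed coins has the same measure.
  rw [Measure.real, Measure.prod_apply_symm hmeas, lintegral_congr hconst, lintegral_const,
    measure_univ, mul_one, ENNReal.toReal_ofReal]
  rw [← hsection fun _ => true]
  exact measureReal_nonneg
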